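/- Let $p$ be a prime number and let $h'$ be an integer with $1\le h'\le 10$. Fix an embedding $\overline{\mathbb{Q}}\hookrightarrow\overline{\mathbb{Q}}_p$, and for a power $q=p^a$ ($a\ge 1$) let $\nu_q$ be the $p$-adic valuation on $\overline{\mathbb{Q}}_p$ normalized by $\nu_q(q)=1$. For a polynomial $Q(T)=\prod_j(1-\beta_jT)\in\mathbb{Q}[T]$ with $\beta_j\in\overline{\mathbb{Q}}$, put $Q_{<0}(T)=\prod_{\nu_q(\beta_j)<0}(1-\beta_jT)\in\mathbb{Q}_p[T]$. Then there exist a power $q=p^a$ of $p$ with $a\ge 1$, a polynomial $$L(T)=\prod_{i=1}^{20}(1-\gamma_iT)\in 1+T\mathbb{Q}[T]\qquad(\gamma_i\in\overline{\mathbb{Q}})$$ of degree $20$, an integer $e\ge 1$ and an irreducible polynomial $Q(T)\in\mathbb{Q}[T]$ with $Q(0)=1$ such that: - all complex roots of $L(T)$ have absolute value one; - no root of $L(T)$ is a root of unity; - $L(T)\in\mathbb{Z}_\ell[T]$ for all prime numbers $\ell\ne p$; - the roots $\alpha_1,\dots,\alpha_{20}\in\overline{\mathbb{Q}}$ of $L(T)$,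 counted with multiplicity, can be ordered so that $\nu_q(\alpha_i)=-1/h'$ for $1\le i\le h'$, $\nu_q(\alpha_i)=0$ for $h'+1\le i\le 20-h'$, and $\nu_q(\alpha_i)=1/h'$ for $20-h'+1\le i\le 20$; - $L(T)=Q(T)^e$; - $Q_{<0}(T)$ is an irreducible polynomial in $\mathbb{Q}_p[T]$; - the discriminant $\mathrm{disc}(\mathbb{Q}(\gamma_1))$ of the number field $\mathbb{Q}(\gamma_1)$ is a square, or $e$ is even (or both). -/

import Mathlib

open Polynomial IntermediateField

noncomputable section

/-- The field of algebraic numbers. -/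
abbrev Qbar : Type := AlgebraicClosure ℚ

instance isAlgClosure_Qbar : IsAlgClosure ℚ Qbar where
  isAlgClosed := AlgebraicClosure.isAlgClosed ℚ
  isAlgebraic := AlgebraicClosure.isAlgebraic ℚ

instance isAlgebraic_Qbar : Algebra.IsAlgebraic ℚ Qbar := IsAlgClosure.isAlgebraic

/-- The `p`-adic valuation on an algebraic closure of `ℚ_p`, normalized by `ν_q(q) = 1`
(for `q` a power of `p` with positive exponent). `PadicAlgCl p` is Mathlib's algebraic closure
of `ℚ_[p]`, with the unique norm extending the `p`-adic norm. -/
def nu (p : ℕ) [Fact p.Prime] (q : ℕ) (x : PadicAlgCl p) : WithTop ℝ :=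
  open Classical in if x = 0 then ⊤ else ((-Real.logb (q : ℝ) ‖x‖ : ℝ) : WithTop ℝ)

/-- The multiset of the `β_j` in the factorization `Q(T) = ∏_j (1 - β_j T)` of a polynomial with
constant term `1`, i.e. the inverses of the roots with multiplicity. -/
def inverseRoots (Q : ℚ[X]) : Multiset Qbar :=
  (Q.aroots Qbar).map fun r => r⁻¹

open Classical in
/-- `Q_{<0}(T) = ∏_{ν_q(β_j) < 0} (1 - β_j T)`, as a polynomial over the algebraic closure
of `ℚ_p`. -/
def negPart (p : ℕ) [Fact p.Prime] (ι : Qbar →+* PadicAlgCl p) (q : ℕ) (Q : ℚ[X]) :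
    (PadicAlgCl p)[X] :=
  (((inverseRoots Q).filter fun β => nu p q (ι β) < 0).map fun β => 1 - C (ι β) * X).prod

/-- The conditions on a polynomial `L(T) ∈ 1 + T ℚ[T]` of degree `2m`, for the power `q` of `p`,
with the integers `h` and `e` that occur in them made explicit. -/
structure SatisfiesCondition (p : ℕ) [Fact p.Prime] (ι : Qbar →+* PadicAlgCl p)
    (q m h e : ℕ) (L : ℚ[X]) : Prop where
  q_eq_pow : ∃ a : ℕ, 1 ≤ a ∧ q = p ^ a
  coeff_zero : L.coeff 0 = 1
  natDegree_eq : L.natDegree = 2 * m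
  norm_root : ∀ z : ℂ, aeval z L = 0 → ‖z‖ = 1
  not_rootOfUnity : ∀ z : ℂ, aeval z L = 0 → ∀ n : ℕ, 1 ≤ n → z ^ n ≠ 1
  integral : ∀ (l : ℕ) [Fact l.Prime], l ≠ p →
    L.map (algebraMap ℚ ℚ_[l]) ∈ Polynomial.lifts (algebraMap ℤ_[l] ℚ_[l])
  one_le_h : 1 ≤ h
  h_le_m : h ≤ m
  slopes : ∃ α : Fin (2 * m) → Qbar, L.aroots Qbar = Finset.univ.val.map α ∧
    ∀ i : Fin (2 * m),
      ((i : ℕ) < h → nu p q (ι (α i)) = ((-1 / h : ℝ) : WithTop ℝ)) ∧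
      (h ≤ (i : ℕ) → (i : ℕ) < 2 * m - h → nu p q (ι (α i)) = 0) ∧
      (2 * m - h ≤ (i : ℕ) → nu p q (ι (α i)) = ((1 / h : ℝ) : WithTop ℝ))
  one_le_e : 1 ≤ e
  power : ∃ Q : ℚ[X], Irreducible Q ∧ Q.coeff 0 = 1 ∧ L = Q ^ e ∧
    ∃ P : ℚ_[p][X], P.map (algebraMap ℚ_[p] (PadicAlgCl p)) = negPart p ι q Q ∧ Irreducible P

instance numberField_adjoin_simple (x : Qbar) : NumberField ℚ⟮x⟯ where
  to_charZero := inferInstance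
  to_finiteDimensional :=
    IntermediateField.adjoin.finiteDimensional (Algebra.IsIntegral.isIntegral x)

end

/-!
Take `L = T ^ m * F (T + T⁻¹)` with `F = P + w * G`, `P = C_m - 1`, where `C_m (2 cos θ) =
2 cos (m θ)`, and where `G` is monic of degree `m - h` and `w` is a rational number with denominator
`p ^ a`, `a` prime to `h`, such that `w * G` is less than `1` in absolute value on `[-2, 2]`.

* At the points `2 cos (k π / m)` the values of `F` alternate in sign, so all roots of `F` lie in
  `(-2, 2)`, and all roots of `L` on the unit circle.
* At `p`, exactly `h` roots of `L` are large, of norm `p ^ (a / h)`. As `h` is prime to `a`, each of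
  them has at least `h` conjugates over `ℚ_p`, so the large roots form a single orbit.
* For a root `β` of `L`, the number `β ^ m * P (β + β⁻¹)` is integral away from `p`, and its complex
  absolute values are those of `w * G` at points of `(-2, 2)`, hence less than `1`. It is nonzero
  because the real roots of `G` are even integers, at which `P` takes odd values. By the product
  formula some conjugate of `β` is large at `p`. Therefore every nonconstant rational factor of `L`
  has a large root, hence all `h` of them, and `L` is irreducible. This also excludes roots of
  unity.
* Up to squares and the sign `(-1) ^ m`, the discriminant of `ℚ(γ)`, for a root `γ` of `L`, is the
  norm of the derivative of `L` at `γ`. This is `(-1) ^ m * F 2 * F (-2)` times the norm of the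
  derivative of `F` at `γ + γ⁻¹`, which is a square because the involution `γ ↦ γ⁻¹` fixes
  `γ + γ⁻¹`. So it suffices to choose `w` and `G` such that `F 2 * F (-2)` is a square.
-/

section reciprocalLift

variable {R : Type*} [CommRing R] {F : R[X]}

/-- The reciprocal polynomial `T ^ m * F (T + T⁻¹)`, where `m` is the degree of `F`. -/
noncomputable def reciprocalLift (F : R[X]) : R[X] :=
  ∑ j ∈ Finset.range (F.natDegree + 1), C (F.coeff j) * X ^ (F.natDegree - j) * (X ^ 2 + 1) ^ j

theorem map_reciprocalLift {S : Type*} [CommRing S] [Nontrivial S] (f : R →+* S) (hF : F.Monic) :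
    (reciprocalLift F).map f = reciprocalLift (F.map f) := by
  simp [reciprocalLift, Polynomial.map_sum, hF.natDegree_map f]

theorem eval_reciprocalLift_eq_sum (z : R) :
    (reciprocalLift F).eval z = ∑ j ∈ Finset.range (F.natDegree + 1),
      F.coeff j * z ^ (F.natDegree - j) * (z ^ 2 + 1) ^ j := by
  simp [reciprocalLift, eval_finsetSum]

theorem coeff_zero_reciprocalLift : (reciprocalLift F).coeff 0 = F.leadingCoeff := by
  rw [coeff_zero_eq_eval_zero, eval_reciprocalLift_eq_sum, Finset.sum_range_succ,
    Finset.sum_eq_zero fun j hj => ?_]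
  · simp
  · simp [Nat.sub_ne_zero_of_lt (Finset.mem_range.1 hj)]

theorem eval_reciprocalLift {z x : R} (hx : z ^ 2 + 1 = z * x) :
    (reciprocalLift F).eval z = z ^ F.natDegree * F.eval x := by
  rw [eval_reciprocalLift_eq_sum, eval_eq_sum_range, Finset.mul_sum]
  refine Finset.sum_congr rfl fun j hj => ?_
  rw [hx, mul_pow, ← pow_sub_mul_pow z (Nat.le_of_lt_succ (Finset.mem_range.1 hj))]
  ring

theorem eval_derivative_reciprocalLift {z x : R} (hx : z ^ 2 + 1 = z * x) :
    z * (derivative (reciprocalLift F)).eval z =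
      z ^ F.natDegree * (F.natDegree * F.eval x + (2 * z - x) * (derivative F).eval x) := by
  have hpow (y : R) (n : ℕ) : y * (n * y ^ (n - 1)) = n * y ^ n := by
    rcases n with _ | n
    · simp
    · rw [Nat.succ_sub_one, pow_succ]
      ring
  rw [eval_eq_sum_range (p := F), derivative_eval (p := F), sum_over_range _ (by simp),
    reciprocalLift, derivative_sum, eval_finsetSum, Finset.mul_sum, Finset.mul_sum, Finset.mul_sum,
    ← Finset.sum_add_distrib, Finset.mul_sum]
  refine Finset.sum_congr rfl fun j hj => ?_
  obtain ⟨k, hk⟩ := Nat.exists_eq_add_of_le' (Nat.le_of_lt_succ (Finset.mem_range.1 hj))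
  simp only [hk, derivative_mul, derivative_C, derivative_pow, derivative_add,
    derivative_X, derivative_one, eval_add, eval_mul, eval_C, eval_pow, eval_X, eval_one, eval_zero,
    eval_natCast, hx, map_natCast, Nat.add_sub_cancel, Nat.cast_add, mul_pow, pow_add]
  push_cast
  linear_combination F.coeff j * z ^ j * x ^ j * hpow z k +
    2 * F.coeff j * z ^ (k + 1) * x ^ (j - 1) * hpow z j + F.coeff j * z ^ (k + j) * hpow x j

theorem degree_reciprocalLift_sub_lt (hF : F.Monic) :
    (reciprocalLift F - (X ^ 2 + 1) ^ F.natDegree).degree <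
      ((2 * F.natDegree : ℕ) : WithBot ℕ) := by
  simp only [reciprocalLift, Finset.sum_range_succ, hF.coeff_natDegree, map_one, Nat.sub_self,
    pow_zero, mul_one, one_mul, add_sub_cancel_right]
  refine (degree_sum_le _ _).trans_lt ((Finset.sup_lt_iff (WithBot.bot_lt_coe _)).2 fun j hj => ?_)
  have hj' := Finset.mem_range.1 hj
  have : (C (F.coeff j) * X ^ (F.natDegree - j) * (X ^ 2 + 1) ^ j).natDegree ≤
      F.natDegree - j + j * 2 := by
    compute_degree
  exact (natDegree_le_iff_degree_le.1 this).trans_lt (by exact_mod_cast (by lia))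

theorem monic_X_sq_add_one : (X ^ 2 + 1 : R[X]).Monic := by
  simpa using monic_X_pow_add_C (1 : R) two_ne_zero

theorem degree_X_sq_add_one_pow [Nontrivial R] (n : ℕ) :
    ((X ^ 2 + 1 : R[X]) ^ n).degree = ((2 * n : ℕ) : WithBot ℕ) := by
  have hdeg : (X ^ 2 + 1 : R[X]).natDegree = 2 := by
    simpa using natDegree_X_pow_add_C (n := 2) (r := (1 : R))
  rw [degree_eq_natDegree (monic_X_sq_add_one.pow n).ne_zero, monic_X_sq_add_one.natDegree_pow,
    hdeg, mul_comm]

theorem monic_reciprocalLift [Nontrivial R] (hF : F.Monic) : (reciprocalLift F).Monic := by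
  rw [← sub_add_cancel (reciprocalLift F) ((X ^ 2 + 1) ^ F.natDegree)]
  refine (monic_X_sq_add_one.pow _).add_of_right ?_
  rw [degree_X_sq_add_one_pow]
  exact degree_reciprocalLift_sub_lt hF

theorem natDegree_reciprocalLift [Nontrivial R] (hF : F.Monic) :
    (reciprocalLift F).natDegree = 2 * F.natDegree := by
  refine natDegree_eq_of_degree_eq_some ?_
  have hlt := degree_reciprocalLift_sub_lt hF
  rw [← degree_X_sq_add_one_pow (R := R)] at hlt ⊢
  rw [← sub_add_cancel (reciprocalLift F) ((X ^ 2 + 1) ^ F.natDegree)]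
  exact degree_add_eq_right_of_degree_lt hlt

variable {K : Type*} [Field K] [Algebra R K] {z : K}

theorem aeval_reciprocalLift (hF : F.Monic) (hz : z ≠ 0) :
    aeval z (reciprocalLift F) = z ^ F.natDegree * aeval (z + z⁻¹) F := by
  rw [← eval_map_algebraMap, ← eval_map_algebraMap, map_reciprocalLift _ hF,
    eval_reciprocalLift (x := z + z⁻¹) (by field_simp), hF.natDegree_map]

theorem ne_zero_of_aeval_reciprocalLift_eq_zero (hF : F.Monic)
    (hroot : aeval z (reciprocalLift F) = 0) : z ≠ 0 := by
  rintro rfl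
  rw [aeval_def, eval₂_at_zero, coeff_zero_reciprocalLift, hF.leadingCoeff, map_one] at hroot
  exact one_ne_zero hroot

theorem aeval_add_inv_eq_zero (hF : F.Monic) (hroot : aeval z (reciprocalLift F) = 0) :
    aeval (z + z⁻¹) F = 0 := by
  have hz := ne_zero_of_aeval_reciprocalLift_eq_zero hF hroot
  rw [aeval_reciprocalLift hF hz] at hroot
  exact (mul_eq_zero.1 hroot).resolve_left (pow_ne_zero _ hz)

theorem aeval_inv_reciprocalLift_eq_zero (hF : F.Monic)
    (hroot : aeval z (reciprocalLift F) = 0) : aeval z⁻¹ (reciprocalLift F) = 0 := by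
  have hz := ne_zero_of_aeval_reciprocalLift_eq_zero hF hroot
  rw [aeval_reciprocalLift hF (inv_ne_zero hz), inv_inv, add_comm, aeval_add_inv_eq_zero hF hroot,
    mul_zero]

end reciprocalLift

section discriminant

theorem isSquare_discr_of_isSquare_discr_basis {K ι : Type*} [Field K] [NumberField K] [Fintype ι]
    [DecidableEq ι] (b : Module.Basis ι ℚ K) (hb : IsSquare (Algebra.discr ℚ b)) :
    IsSquare (NumberField.discr K) := by
  set c := (NumberField.integralBasis K).reindex ((NumberField.integralBasis K).indexEquiv b)
  have hc : Algebra.discr ℚ c = NumberField.discr K := by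
    rw [Module.Basis.coe_reindex, Algebra.discr_reindex, NumberField.coe_discr]
  have hdet : Algebra.discr ℚ b = (c.toMatrix b).det ^ 2 * NumberField.discr K := by
    rw [← hc, ← Algebra.discr_of_matrix_vecMul, Module.Basis.toMatrix_map_vecMul]
  have hdet0 : (c.toMatrix b).det ≠ 0 := by
    intro h0
    exact Algebra.discr_not_zero_of_basis ℚ b (by rw [hdet, h0]; ring)
  obtain ⟨s, hs⟩ := hb
  refine Rat.isSquare_intCast_iff.1 ⟨s / (c.toMatrix b).det, ?_⟩
  field_simp
  linear_combination hs - hdet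

variable {F K : Type*} [Field F] [Field K] [Algebra F K]

theorem norm_algebraMap_sub_gen (pb : PowerBasis F K) (x : F) :
    Algebra.norm F (algebraMap F K x - pb.gen) = (minpoly F pb.gen).eval x := by
  classical
  rw [Algebra.norm_eq_matrix_det pb.basis, map_sub, ← charpoly_leftMulMatrix, Matrix.eval_charpoly,
    AlgHom.commutes]
  rfl

theorem isSquare_norm_of_involution [FiniteDimensional F K] (σ : K ≃ₐ[F] K) (hσ : orderOf σ = 2)
    {y : K} (hy : σ y = y) : IsSquare (Algebra.norm F y) := by
  set E := fixedField (Subgroup.zpowers σ)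
  have hfinrank : Module.finrank E K = 2 := by
    rw [finrank_fixedField_eq_card, Nat.card_zpowers, hσ]
  have hyE : y ∈ E := by
    rintro ⟨τ, n, rfl⟩
    have hle : Subgroup.zpowers σ ≤ MulAction.stabilizer (K ≃ₐ[F] K) y :=
      Subgroup.zpowers_le.2 hy
    exact hle (Subgroup.zpow_mem_zpowers σ n)
  have hnorm := Algebra.norm_norm (R := F) (S := E) (a := algebraMap E K ⟨y, hyE⟩)
  rw [Algebra.norm_algebraMap, hfinrank, map_pow] at hnorm
  exact ⟨_, hnorm.symm.trans (sq _)⟩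

theorem exists_algEquiv_gen_eq_inv [FiniteDimensional F K] (pb : PowerBasis F K)
    (hinv : aeval pb.gen⁻¹ (minpoly F pb.gen) = 0) (hne : pb.gen⁻¹ ≠ pb.gen) :
    ∃ σ : K ≃ₐ[F] K, orderOf σ = 2 ∧ σ pb.gen = pb.gen⁻¹ := by
  set τ : K →ₐ[F] K := pb.lift pb.gen⁻¹ hinv
  set σ : K ≃ₐ[F] K := AlgEquiv.ofBijective τ (Algebra.IsAlgebraic.algHom_bijective τ)
  have hσ : σ pb.gen = pb.gen⁻¹ := pb.lift_gen _ hinv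
  refine ⟨σ, orderOf_eq_prime (AlgEquiv.coe_toAlgHom_injective (pb.algHom_ext ?_)) fun h1 => ?_, hσ⟩
  · change (σ ^ 2) pb.gen = pb.gen
    rw [sq, AlgEquiv.mul_apply, hσ, map_inv₀, hσ, inv_inv]
  · exact hne (by rw [← hσ, h1, AlgEquiv.one_apply])

theorem isSquare_norm_aeval_add_inv [FiniteDimensional F K] (pb : PowerBasis F K)
    (hinv : aeval pb.gen⁻¹ (minpoly F pb.gen) = 0) (hne : pb.gen⁻¹ ≠ pb.gen) (f : F[X]) :
    IsSquare (Algebra.norm F (aeval (pb.gen + pb.gen⁻¹) f)) := by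
  obtain ⟨σ, hord, hσ⟩ := exists_algEquiv_gen_eq_inv pb hinv hne
  refine isSquare_norm_of_involution σ hord ?_
  rw [← aeval_algHom_apply σ, map_add, map_inv₀, hσ, inv_inv, add_comm]

theorem norm_aeval_derivative_reciprocalLift {f : F[X]} (hf : f.Monic) (pb : PowerBasis F K)
    (hpb : minpoly F pb.gen = reciprocalLift f) :
    Algebra.norm F (aeval pb.gen (derivative (reciprocalLift f))) =
      (-1) ^ f.natDegree * (f.eval 2 * f.eval (-2)) *
        Algebra.norm F (aeval (pb.gen + pb.gen⁻¹) (derivative f)) := by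
  set γ := pb.gen
  have hroot : aeval γ (reciprocalLift f) = 0 := hpb ▸ minpoly.aeval F γ
  have hγ : γ ≠ 0 := ne_zero_of_aeval_reciprocalLift_eq_zero hf hroot
  have hnorm : Algebra.norm F γ = 1 := by
    rw [Algebra.PowerBasis.norm_gen_eq_coeff_zero_minpoly, ← pb.natDegree_minpoly, hpb,
      natDegree_reciprocalLift hf, coeff_zero_reciprocalLift, hf.leadingCoeff, pow_mul]
    simp
  have hone : Algebra.norm F (algebraMap F K 1 - γ) = f.eval 2 := by
    rw [norm_algebraMap_sub_gen, hpb, eval_reciprocalLift (x := 2) (by norm_num)]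
    simp
  have hneg : Algebra.norm F (algebraMap F K (-1) - γ) = (-1) ^ f.natDegree * f.eval (-2) := by
    rw [norm_algebraMap_sub_gen, hpb, eval_reciprocalLift (x := -2) (by norm_num)]
  have hderiv := eval_derivative_reciprocalLift (F := f.map (algebraMap F K)) (z := γ)
    (x := γ + γ⁻¹) (by field_simp)
  rw [← map_reciprocalLift _ hf, derivative_map, derivative_map, eval_map_algebraMap,
    eval_map_algebraMap, eval_map_algebraMap, aeval_add_inv_eq_zero hf hroot, mul_zero, zero_add,
    hf.natDegree_map] at hderiv
  have hmul : γ ^ 2 * aeval γ (derivative (reciprocalLift f)) = γ ^ f.natDegree *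
      ((algebraMap F K 1 - γ) * (algebraMap F K (-1) - γ)) * aeval (γ + γ⁻¹) (derivative f) := by
    rw [sq, mul_assoc, hderiv, map_neg, map_one]
    field_simp
    ring
  have h := congrArg (Algebra.norm F) hmul
  simp only [map_mul, map_pow, hnorm, hone, hneg, one_pow, one_mul] at h
  rw [h]
  ring

theorem isSquare_discr_of_minpoly_eq_reciprocalLift {K : Type*} [Field K] [NumberField K]
    {f : ℚ[X]} (hf : f.Monic) (pb : PowerBasis ℚ K) (hpb : minpoly ℚ pb.gen = reciprocalLift f)
    (hsq : IsSquare (f.eval 2 * f.eval (-2))) : IsSquare (NumberField.discr K) := by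
  refine isSquare_discr_of_isSquare_discr_basis pb.basis ?_
  have hfinrank : Module.finrank ℚ K = 2 * f.natDegree := by
    rw [pb.finrank, ← pb.natDegree_minpoly, hpb, natDegree_reciprocalLift hf]
  have hinv : aeval pb.gen⁻¹ (minpoly ℚ pb.gen) = 0 := by
    rw [hpb]
    exact aeval_inv_reciprocalLift_eq_zero hf (hpb ▸ minpoly.aeval ℚ pb.gen)
  have hne : pb.gen⁻¹ ≠ pb.gen := by
    intro h
    have hmem : pb.gen ∈ (algebraMap ℚ K).range := by
      rcases inv_eq_self₀.1 h with h | h | h <;> rw [h]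
      exacts [neg_mem (one_mem _), zero_mem _, one_mem _]
    rw [← minpoly.natDegree_eq_one_iff, hpb, natDegree_reciprocalLift hf] at hmem
    lia
  have hsign : (-1 : ℚ) ^ (2 * f.natDegree * (2 * f.natDegree - 1) / 2) = (-1) ^ f.natDegree := by
    rw [mul_assoc, Nat.mul_div_cancel_left _ two_pos, mul_comm]
    rcases Nat.eq_zero_or_pos f.natDegree with h0 | h0
    · simp [h0]
    · rw [pow_mul, Odd.neg_one_pow ⟨f.natDegree - 1, by lia⟩]
  rw [Algebra.discr_powerBasis_eq_norm, hfinrank, hsign, hpb,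
    norm_aeval_derivative_reciprocalLift hf pb hpb, mul_assoc, ← mul_assoc, ← mul_pow, neg_one_mul,
    neg_neg, one_pow, one_mul]
  exact hsq.mul (isSquare_norm_aeval_add_inv pb hinv hne _)

end discriminant

section ultrametric

variable {K : Type*} [NormedField K] [IsUltrametricDist K] {f : K[X]} {x : K}

theorem norm_eval_le_one (hf : ∀ i, ‖f.coeff i‖ ≤ 1) (hx : ‖x‖ ≤ 1) : ‖f.eval x‖ ≤ 1 := by
  rw [eval_eq_sum_range]
  refine IsUltrametricDist.norm_sum_le_of_forall_le_of_nonneg zero_le_one fun i _ => ?_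
  rw [norm_mul, norm_pow]
  exact mul_le_one₀ (hf i) (by positivity) (pow_le_one₀ (norm_nonneg _) hx)

theorem norm_eval_of_one_lt_norm (hmonic : f.Monic) (hf : ∀ i, ‖f.coeff i‖ ≤ 1) (hx : 1 < ‖x‖) :
    ‖f.eval x‖ = ‖x‖ ^ f.natDegree := by
  rw [eval_eq_sum_range, Finset.sum_range_succ, hmonic.coeff_natDegree, one_mul]
  have hlt : ‖∑ i ∈ Finset.range f.natDegree, f.coeff i * x ^ i‖ < ‖x ^ f.natDegree‖ := by
    obtain h0 | h0 := Nat.eq_zero_or_pos f.natDegree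
    · simp [h0]
    · refine lt_of_le_of_lt ?_ ((pow_lt_pow_right₀ hx (Nat.sub_one_lt h0.ne')).trans_eq
        (norm_pow _ _).symm)
      refine IsUltrametricDist.norm_sum_le_of_forall_le_of_nonneg (by positivity) fun i hi => ?_
      rw [norm_mul, norm_pow, ← one_mul (‖x‖ ^ (f.natDegree - 1))]
      gcongr
      · exact hf i
      · exact hx.le
      · exact Nat.le_sub_one_of_lt (Finset.mem_range.1 hi)
  rw [IsUltrametricDist.norm_add_eq_max_of_norm_ne_norm hlt.ne, max_eq_right hlt.le, norm_pow]

theorem norm_le_one_of_eval_eq_zero (hmonic : f.Monic) (hf : ∀ i, ‖f.coeff i‖ ≤ 1)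
    (hx : f.eval x = 0) : ‖x‖ ≤ 1 := by
  by_contra! hlt
  have := norm_eval_of_one_lt_norm hmonic hf hlt
  rw [hx, norm_zero] at this
  exact (pow_pos (one_pos.trans hlt) _).ne this

theorem norm_add_inv_of_one_lt_norm (hx : 1 < ‖x‖) : ‖x + x⁻¹‖ = ‖x‖ := by
  have hlt : ‖x⁻¹‖ < ‖x‖ := by
    rw [norm_inv]
    exact (inv_lt_one_of_one_lt₀ hx).trans hx
  rw [IsUltrametricDist.norm_add_eq_max_of_norm_ne_norm hlt.ne', max_eq_left hlt.le]

theorem norm_aeval_intPolynomial_le_one (G : ℤ[X]) (hx : ‖x‖ ≤ 1) : ‖aeval x G‖ ≤ 1 := by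
  rw [← eval_map_algebraMap]
  refine norm_eval_le_one (fun i => ?_) hx
  rw [coeff_map]
  exact IsUltrametricDist.norm_intCast_le_one K _

theorem norm_aeval_intPolynomial_of_one_lt_norm {G : ℤ[X]} (hG : G.Monic) (hx : 1 < ‖x‖) :
    ‖aeval x G‖ = ‖x‖ ^ G.natDegree := by
  rw [← eval_map_algebraMap, norm_eval_of_one_lt_norm (hG.map _) _ hx, hG.natDegree_map]
  intro i
  rw [coeff_map]
  exact IsUltrametricDist.norm_intCast_le_one K _

theorem norm_sub_of_norm_lt {y : K} (h : ‖y‖ < ‖x‖) : ‖x - y‖ = ‖x‖ := by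
  rw [sub_eq_add_neg, IsUltrametricDist.norm_add_eq_max_of_norm_ne_norm (by simpa using h.ne'),
    norm_neg, max_eq_left h.le]

open Classical in
theorem norm_multiset_prod_sub (hx : 1 < ‖x‖) (s : Multiset K)
    (hs : ∀ r ∈ s, ‖r‖ ≤ 1 ∨ ‖r‖ = ‖x‖ ^ 2) :
    ‖(s.map (x - ·)).prod‖ = ‖x‖ ^ (s.card + (s.filter (1 < ‖·‖)).card) := by
  induction s using Multiset.induction with
  | empty => simp
  | cons r s ih =>
    rw [Multiset.map_cons, Multiset.prod_cons, norm_mul,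
      ih fun y hy => hs y (Multiset.mem_cons_of_mem hy)]
    rcases hs r (Multiset.mem_cons_self r s) with hr | hr
    · rw [Multiset.filter_cons_of_neg (p := (1 < ‖·‖)) _ hr.not_gt, Multiset.card_cons,
        norm_sub_of_norm_lt (hr.trans_lt hx)]
      ring
    · have hlt : ‖x‖ < ‖r‖ := hr ▸ lt_self_pow₀ hx one_lt_two
      rw [Multiset.filter_cons_of_pos (p := (1 < ‖·‖)) _ (hx.trans hlt), Multiset.card_cons,
        Multiset.card_cons, norm_sub_rev, norm_sub_of_norm_lt hlt, hr]
      ring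

end ultrametric

section padic

variable {p : ℕ} [Fact p.Prime]

theorem norm_pow_natDegree_minpoly (r : PadicAlgCl p) :
    ‖r‖ ^ (minpoly ℚ_[p] r).natDegree = ‖(minpoly ℚ_[p] r).coeff 0‖ := by
  rw [← PadicAlgCl.spectralNorm_eq, spectralNorm.spectralNorm_eq_norm_coeff_zero_rpow,
    ← Real.rpow_natCast, ← Real.rpow_mul (norm_nonneg _), one_div_mul_cancel, Real.rpow_one]
  exact_mod_cast (minpoly.natDegree_pos (Algebra.IsIntegral.isIntegral r)).ne'

theorem norm_eq_of_aeval_minpoly_eq_zero {r s : PadicAlgCl p}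
    (hs : aeval s (minpoly ℚ_[p] r) = 0) : ‖s‖ = ‖r‖ := by
  rw [← PadicAlgCl.spectralNorm_eq, ← PadicAlgCl.spectralNorm_eq, spectralNorm, spectralNorm,
    minpoly.eq_of_root (Algebra.IsAlgebraic.isAlgebraic r) hs]

theorem dvd_natDegree_minpoly {r : PadicAlgCl p} {h : ℕ} {e : ℤ} (hcop : IsCoprime (h : ℤ) e)
    (hr : r ≠ 0) (hrn : ‖r‖ ^ h = (p : ℝ) ^ e) : h ∣ (minpoly ℚ_[p] r).natDegree := by
  have hp : 1 < (p : ℝ) := by exact_mod_cast (Fact.out : p.Prime).one_lt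
  obtain ⟨k, hk⟩ := Padic.padicNormE.image
    (minpoly.coeff_zero_ne_zero (Algebra.IsIntegral.isIntegral (R := ℚ_[p]) r) hr)
  set d := (minpoly ℚ_[p] r).natDegree with hd
  have hnorm : ‖r‖ ^ d = (p : ℝ) ^ (-k) := by
    rw [hd, norm_pow_natDegree_minpoly, hk]
    push_cast
    rfl
  have hpow : (p : ℝ) ^ (-k * h) = (p : ℝ) ^ (e * d) := by
    rw [zpow_mul, zpow_mul, ← hnorm, ← hrn, zpow_natCast, zpow_natCast, ← pow_mul, ← pow_mul,
      mul_comm]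
  have hkd : -k * h = e * d := zpow_right_injective₀ (by linarith) hp.ne' hpow
  exact Int.natCast_dvd_natCast.1 (hcop.dvd_of_dvd_mul_left ⟨-k, by linarith⟩)

theorem aroots_minpoly_le_filter {f : ℚ_[p][X]} (hf : f ≠ 0) {r : PadicAlgCl p}
    (hr : aeval r f = 0) (P : PadicAlgCl p → Prop) [DecidablePred P] (hP : ∀ s, ‖s‖ = ‖r‖ → P s) :
    (minpoly ℚ_[p] r).aroots (PadicAlgCl p) ≤ (f.aroots (PadicAlgCl p)).filter P := by
  refine Multiset.le_filter.2 ⟨?_, fun s hs => hP s ?_⟩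
  · exact roots.le_of_dvd (Polynomial.map_ne_zero hf) (Polynomial.map_dvd _ (minpoly.dvd _ _ hr))
  · exact norm_eq_of_aeval_minpoly_eq_zero (mem_aroots.1 hs).2

theorem le_card_aroots_minpoly {r : PadicAlgCl p} {h : ℕ} {e : ℤ} (hcop : IsCoprime (h : ℤ) e)
    (hr : r ≠ 0) (hrn : ‖r‖ ^ h = (p : ℝ) ^ e) :
    h ≤ ((minpoly ℚ_[p] r).aroots (PadicAlgCl p)).card := by
  rw [IsAlgClosed.card_aroots_eq_natDegree]
  exact Nat.le_of_dvd (minpoly.natDegree_pos (Algebra.IsIntegral.isIntegral r))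
    (dvd_natDegree_minpoly hcop hr hrn)

theorem norm_algebraMap_rat (w : ℚ) : ‖algebraMap ℚ (PadicAlgCl p) w‖ = ‖(w : ℚ_[p])‖ := by
  rw [IsScalarTower.algebraMap_apply ℚ ℚ_[p], norm_algebraMap', eq_ratCast]

theorem exists_intCast_eq_of_padic_norm_le_one {N : ℚ}
    (hN : ∀ (ℓ : ℕ) [Fact ℓ.Prime], ‖(N : ℚ_[ℓ])‖ ≤ 1) : ∃ n : ℤ, (n : ℚ) = N := by
  refine ⟨N.num, Rat.coe_int_num_of_den_eq_one ?_⟩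
  by_contra hden
  obtain ⟨ℓ, hℓ, hdvd⟩ := Nat.exists_prime_and_dvd hden
  have := Fact.mk hℓ
  have := PadicInt.isUnit_den N (hN ℓ)
  rw [PadicInt.isUnit_iff] at this
  have h2 := (PadicInt.norm_natCast_lt_one_iff (p := ℓ)).2 hdvd
  exact h2.ne this

theorem norm_algebraMap_norm_eq_prod {K E : Type*} [Field K] [NumberField K] [NormedField E]
    [IsAlgClosed E] [Algebra ℚ E] (y : K) :
    ‖algebraMap ℚ E (Algebra.norm ℚ y)‖ = ∏ σ : K →ₐ[ℚ] E, ‖σ y‖ := by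
  rw [Algebra.norm_eq_prod_embeddings, norm_prod]

theorem eq_zero_of_forall_norm_le_one {K : Type*} [Field K] [NumberField K] {y : K}
    (hpadic : ∀ (ℓ : ℕ) [Fact ℓ.Prime] (σ : K →ₐ[ℚ] PadicAlgCl ℓ), ‖σ y‖ ≤ 1)
    (hcomplex : ∀ σ : K →ₐ[ℚ] ℂ, ‖σ y‖ < 1) : y = 0 := by
  by_contra hy
  obtain ⟨n, hn⟩ := exists_intCast_eq_of_padic_norm_le_one (N := Algebra.norm ℚ y) fun ℓ _ => by
    rw [← norm_algebraMap_rat, norm_algebraMap_norm_eq_prod]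
    exact Finset.prod_le_one (fun σ _ => norm_nonneg _) fun σ _ => hpadic ℓ σ
  have hlt : ‖(n : ℂ)‖ < 1 := by
    have : Nonempty (K →ₐ[ℚ] ℂ) := ⟨IsAlgClosed.lift⟩
    rw [← Rat.cast_intCast, hn, ← eq_ratCast (algebraMap ℚ ℂ), norm_algebraMap_norm_eq_prod]
    simpa using Finset.prod_lt_prod_of_nonempty (g := 1)
      (fun σ _ => norm_pos_iff.2 ((map_ne_zero σ).2 hy)) (fun σ _ => hcomplex σ)
      Finset.univ_nonempty
  rw [Complex.norm_intCast] at hlt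
  have h0 : n = 0 := Int.abs_lt_one_iff.1 (by exact_mod_cast hlt)
  exact hy (Algebra.norm_eq_zero_iff.1 (by rw [← hn, h0, Int.cast_zero]))

end padic

section pencil

variable {R : Type*} [CommRing R] {P G : ℤ[X]}

/-- The member `P + w * G` of the pencil of polynomials spanned by `P` and `G`. -/
noncomputable def pencil (w : R) (P G : ℤ[X]) : R[X] :=
  P.map (algebraMap ℤ R) + C w * G.map (algebraMap ℤ R)

theorem map_pencil {S : Type*} [CommRing S] (f : R →+* S) (w : R) (P G : ℤ[X]) :
    (pencil w P G).map f = pencil (f w) P G := by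
  rw [pencil, pencil, Polynomial.map_add, Polynomial.map_mul, map_C, Polynomial.map_map,
    Polynomial.map_map, Subsingleton.elim (f.comp (algebraMap ℤ R)) (algebraMap ℤ S)]

theorem aeval_pencil {A : Type*} [CommRing A] [Algebra R A] (w : R) (P G : ℤ[X]) (x : A) :
    aeval x (pencil w P G) = aeval x P + algebraMap R A w * aeval x G := by
  rw [pencil, map_add, map_mul, aeval_C, aeval_map_algebraMap, aeval_map_algebraMap]

variable [Nontrivial R]

theorem degree_C_mul_map_lt (w : R) (hP : P.Monic) (hdeg : G.natDegree < P.natDegree) :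
    (C w * G.map (algebraMap ℤ R)).degree < (P.map (algebraMap ℤ R)).degree := by
  refine degree_lt_degree ?_
  rw [hP.natDegree_map]
  exact ((natDegree_C_mul_le _ _).trans natDegree_map_le).trans_lt hdeg

theorem monic_pencil (w : R) (hP : P.Monic) (hdeg : G.natDegree < P.natDegree) :
    (pencil w P G).Monic :=
  (hP.map _).add_of_left (degree_C_mul_map_lt w hP hdeg)

theorem natDegree_pencil (w : R) (hP : P.Monic) (hdeg : G.natDegree < P.natDegree) :
    (pencil w P G).natDegree = P.natDegree := by
  rw [pencil, natDegree_add_eq_left_of_degree_lt (degree_C_mul_map_lt w hP hdeg), hP.natDegree_map]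

variable {K : Type*} [NormedField K] [IsUltrametricDist K] [Algebra R K] {w : R} {h : ℕ} {t : K}

theorem norm_pow_eq_of_aeval_lift_pencil_eq_zero (hP : P.Monic) (hG : G.Monic)
    (hdeg : G.natDegree + h = P.natDegree) (hh : 0 < h) (h1 : 1 < ‖t‖)
    (ht : aeval t (reciprocalLift (pencil w P G)) = 0) : ‖t‖ ^ h = ‖algebraMap R K w‖ := by
  have hroot := aeval_add_inv_eq_zero (monic_pencil w hP (by lia)) ht
  rw [aeval_pencil, add_eq_zero_iff_eq_neg] at hroot
  have hx := norm_add_inv_of_one_lt_norm h1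
  have hnorm := congrArg norm hroot
  rw [norm_neg, norm_mul, norm_aeval_intPolynomial_of_one_lt_norm hP (hx ▸ h1),
    norm_aeval_intPolynomial_of_one_lt_norm hG (hx ▸ h1), hx, ← hdeg, pow_add, mul_comm] at hnorm
  exact mul_right_cancel₀ (by positivity) hnorm

theorem norm_aeval_lift_pencil (hP : P.Monic) (hG : G.Monic) (hdeg : G.natDegree + h = P.natDegree)
    (hh : 0 < h) (h1 : 1 < ‖t‖) (ht : ‖t‖ ^ (2 * h) = ‖algebraMap R K w‖) :
    ‖aeval t (reciprocalLift (pencil w P G))‖ = ‖t‖ ^ (2 * P.natDegree + h) := by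
  have hlt : G.natDegree < P.natDegree := by lia
  have hx := norm_add_inv_of_one_lt_norm h1
  have hPx : ‖aeval (t + t⁻¹) P‖ = ‖t‖ ^ P.natDegree := by
    rw [norm_aeval_intPolynomial_of_one_lt_norm hP (hx ▸ h1), hx]
  have hGx : ‖algebraMap R K w * aeval (t + t⁻¹) G‖ = ‖t‖ ^ (P.natDegree + h) := by
    rw [norm_mul, ← ht, norm_aeval_intPolynomial_of_one_lt_norm hG (hx ▸ h1), hx, ← pow_add, ← hdeg]
    ring
  have hdom : ‖aeval (t + t⁻¹) P‖ < ‖algebraMap R K w * aeval (t + t⁻¹) G‖ := by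
    rw [hPx, hGx]
    exact pow_lt_pow_right₀ h1 (Nat.lt_add_of_pos_right hh)
  rw [aeval_reciprocalLift (monic_pencil w hP hlt) (norm_pos_iff.1 (one_pos.trans h1)), norm_mul,
    norm_pow, aeval_pencil, IsUltrametricDist.norm_add_eq_max_of_norm_ne_norm hdom.ne,
    max_eq_right hdom.le, hGx, natDegree_pencil w hP hlt, ← pow_add]
  ring

end pencil

theorem norm_eq_one_of_add_inv_eq_ofReal {z : ℂ} {t : ℝ} (hz : z ≠ 0)
    (ht : t ∈ Set.Ioo (-2 : ℝ) 2) (hzt : z + z⁻¹ = t) : ‖z‖ = 1 := by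
  have hquad : z * z + 1 = t * z := by
    rw [← hzt]
    field_simp
  have hre := congrArg Complex.re hquad
  have him := congrArg Complex.im hquad
  simp only [Complex.add_re, Complex.mul_re, Complex.one_re, Complex.ofReal_re, Complex.ofReal_im,
    Complex.add_im, Complex.mul_im, Complex.one_im, zero_mul, sub_zero, add_zero] at hre him
  have him0 : z.im ≠ 0 := by
    intro h0
    rw [h0] at hre
    nlinarith [ht.1, ht.2, sq_nonneg (z.re - 1), sq_nonneg (z.re + 1), sq_nonneg (2 * z.re - t)]
  have hre2 : 2 * z.re = t := mul_right_cancel₀ him0 (by linarith)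
  rw [← sq_eq_sq₀ (norm_nonneg z) zero_le_one, Complex.sq_norm, Complex.normSq_apply]
  subst hre2
  linarith

/-- Data `w`, `P`, `G` for which `reciprocalLift (P + w * G)` is a polynomial as required, with
slopes `±1 / h` for the valuation normalized by `p ^ a`. Here `P` has degree `m`, and `P + w * G`
is the polynomial satisfied by the traces `z + z⁻¹` of the roots `z`. -/
structure IsAdmissible (p h a : ℕ) [Fact p.Prime] (w : ℚ) (P G : ℤ[X]) : Prop where
  monic_left : P.Monic
  monic_right : G.Monic
  natDegree_add : G.natDegree + h = P.natDegree
  one_le_h : 1 ≤ h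
  one_le_a : 1 ≤ a
  coprime : h.Coprime a
  norm_eq : ‖(w : ℚ_[p])‖ = (p : ℝ) ^ a
  norm_le_one : ∀ (ℓ : ℕ) [Fact ℓ.Prime], ℓ ≠ p → ‖(w : ℚ_[ℓ])‖ ≤ 1
  mem_Ioo : ∀ x : ℂ, aeval x (pencil w P G) = 0 → ∃ t ∈ Set.Ioo (-2 : ℝ) 2, (t : ℂ) = x
  norm_aeval_lt_one : ∀ x : ℂ, aeval x (pencil w P G) = 0 → ‖aeval x P‖ < 1
  aeval_ne_zero : ∀ x : ℂ, aeval x (pencil w P G) = 0 → aeval x P ≠ 0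
  isSquare_eval : IsSquare ((pencil w P G).eval 2 * (pencil w P G).eval (-2))

namespace IsAdmissible

variable {p h a : ℕ} [Fact p.Prime] {w : ℚ} {P G : ℤ[X]}

theorem natDegree_lt (H : IsAdmissible p h a w P G) : G.natDegree < P.natDegree := by
  have := H.natDegree_add
  have := H.one_le_h
  lia

theorem monic (H : IsAdmissible p h a w P G) : (pencil w P G).Monic :=
  monic_pencil w H.monic_left H.natDegree_lt

theorem monic_lift (H : IsAdmissible p h a w P G) : (reciprocalLift (pencil w P G)).Monic :=
  monic_reciprocalLift H.monic

theorem natDegree_lift (H : IsAdmissible p h a w P G) :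
    (reciprocalLift (pencil w P G)).natDegree = 2 * P.natDegree := by
  rw [natDegree_reciprocalLift H.monic, natDegree_pencil w H.monic_left H.natDegree_lt]

theorem one_lt_pow (H : IsAdmissible p h a w P G) : 1 < p ^ a :=
  Nat.one_lt_pow (Nat.one_le_iff_ne_zero.1 H.one_le_a) (Fact.out : p.Prime).one_lt

theorem isCoprime (H : IsAdmissible p h a w P G) : IsCoprime (h : ℤ) a :=
  Nat.isCoprime_iff_coprime.2 H.coprime

theorem mem_lifts (H : IsAdmissible p h a w P G) (ℓ : ℕ) [Fact ℓ.Prime] (hℓ : ℓ ≠ p) :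
    (reciprocalLift (pencil w P G)).map (algebraMap ℚ ℚ_[ℓ]) ∈ lifts (algebraMap ℤ_[ℓ] ℚ_[ℓ]) := by
  set w' : ℤ_[ℓ] := ⟨w, H.norm_le_one ℓ hℓ⟩
  have hw' : algebraMap ℚ ℚ_[ℓ] w = algebraMap ℤ_[ℓ] ℚ_[ℓ] w' := eq_ratCast _ w
  refine (Polynomial.mem_lifts _).2 ⟨reciprocalLift (pencil w' P G), ?_⟩
  rw [map_reciprocalLift _ (monic_pencil w' H.monic_left H.natDegree_lt),
    map_reciprocalLift _ H.monic, map_pencil, map_pencil, hw']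

theorem norm_le_one_of_aeval_eq_zero (H : IsAdmissible p h a w P G) {ℓ : ℕ} [Fact ℓ.Prime]
    (hℓ : ℓ ≠ p) {s : PadicAlgCl ℓ} (hs : aeval s (reciprocalLift (pencil w P G)) = 0) :
    ‖s‖ ≤ 1 := by
  rw [← eval_map_algebraMap] at hs
  refine norm_le_one_of_eval_eq_zero (H.monic_lift.map _) (fun i => ?_) hs
  obtain ⟨c, hc⟩ := (lifts_iff_coeff_lifts _).1 (H.mem_lifts ℓ hℓ) i
  rw [coeff_map, eq_ratCast] at hc
  rw [coeff_map, norm_algebraMap_rat, ← hc]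
  exact c.2

theorem norm_pow_eq (H : IsAdmissible p h a w P G) {t : PadicAlgCl p}
    (ht : aeval t (reciprocalLift (pencil w P G)) = 0) (h1 : 1 < ‖t‖) : ‖t‖ ^ h = (p : ℝ) ^ a := by
  rw [norm_pow_eq_of_aeval_lift_pencil_eq_zero H.monic_left H.monic_right H.natDegree_add
    H.one_le_h h1 ht, norm_algebraMap_rat, H.norm_eq]

theorem norm_pow_eq_of_norm_lt_one (H : IsAdmissible p h a w P G) {t : PadicAlgCl p}
    (ht : aeval t (reciprocalLift (pencil w P G)) = 0) (h1 : ‖t‖ < 1) :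
    ‖t‖ ^ h = (p : ℝ) ^ (-a : ℤ) := by
  have h0 := ne_zero_of_aeval_reciprocalLift_eq_zero H.monic ht
  have hinv := H.norm_pow_eq (aeval_inv_reciprocalLift_eq_zero H.monic ht)
    (by rw [norm_inv]; exact (one_lt_inv₀ (norm_pos_iff.2 h0)).2 h1)
  rw [zpow_neg, zpow_natCast, ← hinv, norm_inv, inv_pow, inv_inv]

theorem card_aroots_lift (H : IsAdmissible p h a w P G) (K : Type*) [Field K] [Algebra ℚ K]
    [IsAlgClosed K] :
    ((reciprocalLift (pencil w P G)).aroots K).card = 2 * P.natDegree := by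
  rw [IsAlgClosed.card_aroots_eq_natDegree, H.natDegree_lift]

open Classical in
theorem card_filter_one_lt_norm (H : IsAdmissible p h a w P G) :
    (((reciprocalLift (pencil w P G)).aroots (PadicAlgCl p)).filter (1 < ‖·‖)).card = h := by
  obtain ⟨t, ht⟩ := IsAlgClosed.exists_pow_nat_eq (algebraMap ℚ (PadicAlgCl p) w)
    (n := 2 * h) (by have := H.one_le_h; lia)
  have htw : ‖t‖ ^ (2 * h) = ‖algebraMap ℚ (PadicAlgCl p) w‖ := by rw [← norm_pow, ht]
  have htn : ‖t‖ ^ (2 * h) = (p : ℝ) ^ a := by rw [htw, norm_algebraMap_rat, H.norm_eq]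
  have h1 : 1 < ‖t‖ := by
    refine (one_lt_pow_iff_of_nonneg (norm_nonneg t) (n := 2 * h) ?_).1 ?_
    · have := H.one_le_h
      lia
    · rw [htn]
      exact_mod_cast H.one_lt_pow
  have heval := norm_aeval_lift_pencil H.monic_left H.monic_right H.natDegree_add H.one_le_h h1 htw
  rw [(IsAlgClosed.splits _).aeval_eq_prod_aroots_of_monic H.monic_lift,
    norm_multiset_prod_sub h1, H.card_aroots_lift] at heval
  · exact Nat.add_left_cancel (pow_right_injective₀ (one_pos.trans h1) h1.ne' heval)
  · intro r hr
    refine or_iff_not_imp_left.2 fun hr1 => ?_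
    have hrn := H.norm_pow_eq (mem_aroots.1 hr).2 (not_le.1 hr1)
    rw [← htn, pow_mul] at hrn
    exact (pow_left_inj₀ (norm_nonneg r) (by positivity)
      (Nat.one_le_iff_ne_zero.1 H.one_le_h)).1 hrn

theorem norm_eq_one_of_aeval_eq_zero (H : IsAdmissible p h a w P G) {z : ℂ}
    (hz : aeval z (reciprocalLift (pencil w P G)) = 0) : ‖z‖ = 1 := by
  have hz0 := ne_zero_of_aeval_reciprocalLift_eq_zero H.monic hz
  obtain ⟨t, ht, hzt⟩ := H.mem_Ioo _ (aeval_add_inv_eq_zero H.monic hz)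
  exact norm_eq_one_of_add_inv_eq_ofReal hz0 ht hzt.symm

/-- By the product formula, the integral element `β ^ m * P (β + β⁻¹)` cannot be small at all
places. -/
theorem exists_one_lt_norm_algHom (H : IsAdmissible p h a w P G) {K : Type*} [Field K]
    [NumberField K] {β : K} (hβ : aeval β (reciprocalLift (pencil w P G)) = 0) :
    ∃ σ : K →ₐ[ℚ] PadicAlgCl p, 1 < ‖σ β‖ := by
  by_contra! hle
  have hroot {A : Type} [CommRing A] [Algebra ℚ A] (σ : K →ₐ[ℚ] A) :
      aeval (σ β) (reciprocalLift (pencil w P G)) = 0 := by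
    rw [aeval_algHom_apply, hβ, map_zero]
  have hmap {A : Type} [CommRing A] [Algebra ℚ A] (σ : K →ₐ[ℚ] A) :
      σ (aeval β (reciprocalLift P)) = aeval (σ β) (reciprocalLift P) :=
    (aeval_algHom_apply (σ.restrictScalars ℤ) β _).symm
  have hcomplex (σ : K →ₐ[ℚ] ℂ) : ‖σ (aeval β (reciprocalLift P))‖ =
      ‖aeval (σ β + (σ β)⁻¹) P‖ := by
    rw [hmap, aeval_reciprocalLift H.monic_left
      (ne_zero_of_aeval_reciprocalLift_eq_zero H.monic (hroot σ)), norm_mul, norm_pow,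
      H.norm_eq_one_of_aeval_eq_zero (hroot σ), one_pow, one_mul]
  have hzero : aeval β (reciprocalLift P) = 0 := by
    refine eq_zero_of_forall_norm_le_one (fun ℓ _ σ => ?_) fun σ => ?_
    · rw [hmap]
      refine norm_aeval_intPolynomial_le_one _ ?_
      obtain rfl | hℓ := eq_or_ne ℓ p
      exacts [hle σ, H.norm_le_one_of_aeval_eq_zero hℓ (hroot σ)]
    · rw [hcomplex]
      exact H.norm_aeval_lt_one _ (aeval_add_inv_eq_zero H.monic (hroot σ))
  have σ : K →ₐ[ℚ] ℂ := IsAlgClosed.lift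
  refine H.aeval_ne_zero _ (aeval_add_inv_eq_zero H.monic (hroot σ)) (norm_eq_zero.1 ?_)
  rw [← hcomplex, hzero, map_zero, norm_zero]

theorem exists_root_one_lt_norm (H : IsAdmissible p h a w P G) {B : ℚ[X]}
    (hB : B ∣ reciprocalLift (pencil w P G)) (hdeg : B.degree ≠ 0) :
    ∃ s : PadicAlgCl p, aeval s B = 0 ∧ 1 < ‖s‖ := by
  obtain ⟨β, hβ⟩ := IsAlgClosed.exists_aeval_eq_zero Qbar B hdeg
  have hgen : aeval (AdjoinSimple.gen ℚ β) B = 0 := by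
    refine (algebraMap ℚ⟮β⟯ Qbar).injective ?_
    rw [← aeval_algebraMap_apply, AdjoinSimple.algebraMap_gen, hβ, map_zero]
  obtain ⟨σ, hσ⟩ := H.exists_one_lt_norm_algHom (aeval_eq_zero_of_dvd_aeval_eq_zero hB hgen)
  exact ⟨_, by rw [aeval_algHom_apply, hgen, map_zero], hσ⟩

open Classical in
theorem le_card_filter_one_lt_norm (H : IsAdmissible p h a w P G) {B : ℚ[X]}
    (hB : B ∣ reciprocalLift (pencil w P G)) (hdeg : B.degree ≠ 0) :
    h ≤ ((B.aroots (PadicAlgCl p)).filter (1 < ‖·‖)).card := by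
  obtain ⟨s, hs, hs1⟩ := H.exists_root_one_lt_norm hB hdeg
  have hroot := aeval_eq_zero_of_dvd_aeval_eq_zero hB hs
  have hB0 : B ≠ 0 := ne_zero_of_dvd_ne_zero H.monic_lift.ne_zero hB
  rw [← aeval_map_algebraMap ℚ_[p]] at hs
  rw [← aroots_map (PadicAlgCl p) ℚ_[p]]
  exact (le_card_aroots_minpoly H.isCoprime (ne_zero_of_aeval_reciprocalLift_eq_zero H.monic hroot)
    (by exact_mod_cast H.norm_pow_eq hroot hs1)).trans (Multiset.card_le_card
      (aroots_minpoly_le_filter (Polynomial.map_ne_zero hB0) hs _ fun _ h => hs1.trans_eq h.symm))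

theorem irreducible (H : IsAdmissible p h a w P G) :
    Irreducible (reciprocalLift (pencil w P G)) := by
  classical
  have hpos : 0 < (reciprocalLift (pencil w P G)).natDegree := by
    rw [H.natDegree_lift]
    have := H.natDegree_lt
    lia
  refine H.monic_lift.irreducible_iff_natDegree.2
    ⟨fun h1 => hpos.ne' (by rw [h1, natDegree_one]), fun A B hA hB hAB => ?_⟩
  by_contra! hdeg
  have hcard := H.card_filter_one_lt_norm
  rw [← hAB, aroots_mul (hA.mul hB).ne_zero, Multiset.filter_add, Multiset.card_add] at hcard
  have hA' := H.le_card_filter_one_lt_norm (hAB ▸ dvd_mul_right A B)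
    (mt natDegree_eq_of_degree_eq_some hdeg.1)
  have hB' := H.le_card_filter_one_lt_norm (hAB ▸ dvd_mul_left B A)
    (mt natDegree_eq_of_degree_eq_some hdeg.2)
  have := H.one_le_h
  lia

theorem minpoly_eq (H : IsAdmissible p h a w P G) {K : Type*} [Field K] [Algebra ℚ K] {z : K}
    (hz : aeval z (reciprocalLift (pencil w P G)) = 0) :
    minpoly ℚ z = reciprocalLift (pencil w P G) :=
  (minpoly.eq_of_irreducible_of_monic H.irreducible hz H.monic_lift).symm

theorem pow_ne_one (H : IsAdmissible p h a w P G) {K : Type*} [Field K] [Algebra ℚ K] {z : K}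
    (hz : aeval z (reciprocalLift (pencil w P G)) = 0) {n : ℕ} (hn : n ≠ 0) : z ^ n ≠ 1 := by
  intro hzn
  obtain ⟨s, hs, hs1⟩ := H.exists_root_one_lt_norm dvd_rfl H.irreducible.degree_pos.ne'
  have hdvd : reciprocalLift (pencil w P G) ∣ X ^ n - 1 := by
    rw [← H.minpoly_eq hz]
    exact minpoly.dvd _ _ (by simp [hzn])
  have hsn : s ^ n = 1 := by
    simpa [sub_eq_zero] using aeval_eq_zero_of_dvd_aeval_eq_zero hdvd hs
  have := one_lt_pow₀ hs1 hn
  rw [← norm_pow, hsn, norm_one] at this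
  exact this.false

theorem nodup_aroots (H : IsAdmissible p h a w P G) (K : Type*) [Field K] [Algebra ℚ K]
    [IsAlgClosed K] : ((reciprocalLift (pencil w P G)).aroots K).Nodup :=
  (nodup_aroots_iff_of_splits H.monic_lift.ne_zero (IsAlgClosed.splits _)).2
    H.irreducible.separable

theorem map_inv_aroots (H : IsAdmissible p h a w P G) (K : Type*) [Field K] [Algebra ℚ K]
    [IsAlgClosed K] : ((reciprocalLift (pencil w P G)).aroots K).map (·⁻¹) =
      (reciprocalLift (pencil w P G)).aroots K := by
  refine (((H.nodup_aroots K).map inv_injective).ext (H.nodup_aroots K)).2 fun z => ?_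
  have hinv {z : K} (hz : z ∈ (reciprocalLift (pencil w P G)).aroots K) :
      z⁻¹ ∈ (reciprocalLift (pencil w P G)).aroots K :=
    mem_aroots.2
      ⟨H.monic_lift.ne_zero, aeval_inv_reciprocalLift_eq_zero H.monic (mem_aroots.1 hz).2⟩
  rw [Multiset.mem_map]
  exact ⟨fun ⟨y, hy, hyz⟩ => hyz ▸ hinv hy, fun hz => ⟨z⁻¹, hinv hz, inv_inv z⟩⟩

open Classical in
theorem card_filter_norm_lt_one (H : IsAdmissible p h a w P G) :
    (((reciprocalLift (pencil w P G)).aroots (PadicAlgCl p)).filter (‖·‖ < 1)).card = h := by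
  rw [← H.card_filter_one_lt_norm, ← H.map_inv_aroots, Multiset.filter_map, Multiset.card_map,
    H.map_inv_aroots]
  refine congrArg _ (Multiset.filter_congr fun z hz => ?_)
  have hz0 := ne_zero_of_aeval_reciprocalLift_eq_zero H.monic (mem_aroots.1 hz).2
  rw [Function.comp_apply, norm_inv, inv_lt_one₀ (norm_pos_iff.2 hz0)]

open Classical in
/-- The roots of norm less than one number `h`, and each has at least `h` conjugates. -/
theorem aroots_minpoly_eq_filter (H : IsAdmissible p h a w P G) {r : PadicAlgCl p}
    (hr : aeval r (reciprocalLift (pencil w P G)) = 0) (hr1 : ‖r‖ < 1) :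
    (minpoly ℚ_[p] r).aroots (PadicAlgCl p) =
      ((reciprocalLift (pencil w P G)).aroots (PadicAlgCl p)).filter (‖·‖ < 1) := by
  refine Multiset.eq_of_le_of_card_le ?_ ?_
  · rw [← aroots_map (PadicAlgCl p) ℚ_[p] (reciprocalLift _)]
    exact aroots_minpoly_le_filter (Polynomial.map_ne_zero H.monic_lift.ne_zero)
      (by rwa [aeval_map_algebraMap]) _ fun _ h => h.trans_lt hr1
  · rw [H.card_filter_norm_lt_one]
    exact le_card_aroots_minpoly H.isCoprime.neg_right
      (ne_zero_of_aeval_reciprocalLift_eq_zero H.monic hr) (H.norm_pow_eq_of_norm_lt_one hr hr1)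

end IsAdmissible

theorem nu_eq_of_norm_pow_eq {p q h : ℕ} [Fact p.Prime] (hq : 1 < q) (hh : h ≠ 0) {k : ℤ}
    {x : PadicAlgCl p} (hx : ‖x‖ ^ h = (q : ℝ) ^ k) : nu p q x = ((-k / h : ℝ) : WithTop ℝ) := by
  have hx0 : x ≠ 0 := by
    rintro rfl
    rw [norm_zero, zero_pow hh] at hx
    exact (zpow_pos (by positivity) k).ne hx
  have hlog := congrArg (Real.logb q) hx
  rw [Real.logb_pow, ← Real.rpow_intCast, Real.logb_rpow (by positivity)
    (by exact_mod_cast hq.ne')] at hlog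
  rw [nu, if_neg hx0, ← hlog, WithTop.coe_inj]
  field_simp

theorem nu_lt_zero_iff {p q : ℕ} [Fact p.Prime] (hq : 1 < q) {x : PadicAlgCl p} (hx : x ≠ 0) :
    nu p q x < 0 ↔ 1 < ‖x‖ := by
  have hq' : (1 : ℝ) < q := by exact_mod_cast hq
  rw [nu, if_neg hx, ← WithTop.coe_zero, WithTop.coe_lt_coe, neg_lt_zero,
    Real.logb_pos_iff hq' (norm_pos_iff.2 hx)]

theorem map_aroots_Qbar {p : ℕ} [Fact p.Prime] (ι : Qbar →+* PadicAlgCl p) (Q : ℚ[X]) :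
    (Q.aroots Qbar).map ι = Q.aroots (PadicAlgCl p) := by
  rw [aroots_def, aroots_def, ← (IsAlgClosed.splits _).roots_map, Polynomial.map_map,
    Subsingleton.elim (ι.comp (algebraMap ℚ Qbar)) (algebraMap ℚ (PadicAlgCl p))]

theorem aeval_map_eq_zero_of_mem_aroots {p : ℕ} [Fact p.Prime] (ι : Qbar →+* PadicAlgCl p)
    {Q : ℚ[X]} {β : Qbar} (hβ : β ∈ Q.aroots Qbar) : aeval (ι β) Q = 0 :=
  (mem_aroots.1 (map_aroots_Qbar ι Q ▸ Multiset.mem_map_of_mem ι hβ)).2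

theorem eq_C_coeff_zero_mul_prod_one_sub {K : Type*} [Field K] {f : K[X]} (hf : f.Monic)
    (hs : f.Splits) (h0 : f.coeff 0 ≠ 0) :
    f = C (f.coeff 0) * (f.roots.map fun s => 1 - C s⁻¹ * X).prod := by
  have hcoeff : f.coeff 0 = (f.roots.map fun s => -s).prod := by
    rw [coeff_zero_eq_eval_zero, hs.eval_eq_prod_roots_of_monic hf]
    simp
  have hfactor : ∀ s ∈ f.roots, X - C s = C (-s) * (1 - C s⁻¹ * X) := by
    intro s hs
    have hs0 : s ≠ 0 := by
      rintro rfl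
      exact h0 (coeff_zero_eq_eval_zero f ▸ isRoot_of_mem_roots hs)
    rw [mul_sub, ← mul_assoc, ← C_mul, neg_mul, mul_inv_cancel₀ hs0, C_neg, C_neg, C_1]
    ring
  conv_lhs =>
    rw [hs.eq_prod_roots_of_monic hf, Multiset.map_congr rfl hfactor, Multiset.prod_map_mul]
  rw [hcoeff, map_multiset_prod, Multiset.map_map]
  rfl

theorem exists_fin_enumeration {β : Type*} (A B D : Multiset β) {n : ℕ}
    (hn : A.card + B.card + D.card = n) :
    ∃ f : Fin n → β, A + B + D = Finset.univ.val.map f ∧ ∀ i : Fin n,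
      ((i : ℕ) < A.card → f i ∈ A) ∧
      (A.card ≤ (i : ℕ) → (i : ℕ) < A.card + B.card → f i ∈ B) ∧
      (A.card + B.card ≤ (i : ℕ) → f i ∈ D) := by
  obtain ⟨A, rfl⟩ := Quot.exists_rep A
  obtain ⟨B, rfl⟩ := Quot.exists_rep B
  obtain ⟨D, rfl⟩ := Quot.exists_rep D
  simp only [Multiset.quot_mk_to_coe'', Multiset.coe_card, Multiset.coe_add, Multiset.mem_coe,
    Fin.univ_val_map] at hn ⊢
  subst hn
  refine ⟨fun i => (A ++ B ++ D)[(i : ℕ)]'(by grind), ?_, fun i => ?_⟩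
  · congr
    exact List.ext_getElem (by grind) fun n _ _ => by simp
  · grind

open Classical in
theorem filter_add_filter_add_filter_eq {α β : Type*} [LinearOrder β] (f : α → β) (b : β)
    (s : Multiset α) :
    s.filter (b < f ·) + s.filter (f · = b) + s.filter (f · < b) = s := by
  ext x
  rw [Multiset.count_add, Multiset.count_add, Multiset.count_filter, Multiset.count_filter,
    Multiset.count_filter]
  rcases lt_trichotomy (f x) b with h | h | h
  · simp [h, h.ne, h.not_gt]
  · simp [h]
  · simp [h, h.ne', h.not_gt]

namespace IsAdmissible

variable {p h a : ℕ} [Fact p.Prime] {w : ℚ} {P G : ℤ[X]}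

theorem slopes (H : IsAdmissible p h a w P G) (ι : Qbar →+* PadicAlgCl p) :
    ∃ α : Fin (2 * P.natDegree) → Qbar,
      (reciprocalLift (pencil w P G)).aroots Qbar = Finset.univ.val.map α ∧
      ∀ i : Fin (2 * P.natDegree),
        ((i : ℕ) < h → nu p (p ^ a) (ι (α i)) = ((-1 / h : ℝ) : WithTop ℝ)) ∧
        (h ≤ (i : ℕ) → (i : ℕ) < 2 * P.natDegree - h → nu p (p ^ a) (ι (α i)) = 0) ∧
        (2 * P.natDegree - h ≤ (i : ℕ) → nu p (p ^ a) (ι (α i)) = ((1 / h : ℝ) : WithTop ℝ)) := by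
  classical
  have hh : h ≠ 0 := Nat.one_le_iff_ne_zero.1 H.one_le_h
  set M := (reciprocalLift (pencil w P G)).aroots Qbar
  have hA : (M.filter (1 < ‖ι ·‖)).card = h := by
    rw [← H.card_filter_one_lt_norm, ← map_aroots_Qbar ι, Multiset.filter_map, Multiset.card_map]
    rfl
  have hD : (M.filter (‖ι ·‖ < 1)).card = h := by
    rw [← H.card_filter_norm_lt_one, ← map_aroots_Qbar ι, Multiset.filter_map, Multiset.card_map]
    rfl
  have hsplit := filter_add_filter_add_filter_eq (‖ι ·‖) 1 M
  have hcard := (congrArg Multiset.card hsplit).trans (H.card_aroots_lift Qbar)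
  rw [Multiset.card_add, Multiset.card_add] at hcard
  have hAB : h + (M.filter (‖ι ·‖ = 1)).card =
      2 * P.natDegree - h := by lia
  obtain ⟨α, hα, hmem⟩ := exists_fin_enumeration _ _ _ hcard
  rw [hsplit] at hα
  simp only [hA, hAB, Multiset.mem_filter] at hmem
  refine ⟨α, hα, fun i => ⟨fun hi => ?_, fun hi hi' => ?_, fun hi => ?_⟩⟩
  · obtain ⟨hroot, hnorm⟩ := (hmem i).1 hi
    have := H.norm_pow_eq (aeval_map_eq_zero_of_mem_aroots ι hroot) hnorm
    simpa using nu_eq_of_norm_pow_eq (k := 1) H.one_lt_pow hh (by simpa using this)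
  · simpa using nu_eq_of_norm_pow_eq (k := 0) H.one_lt_pow hh (by simp [((hmem i).2.1 hi hi').2])
  · obtain ⟨hroot, hnorm⟩ := (hmem i).2.2 hi
    have := H.norm_pow_eq_of_norm_lt_one (aeval_map_eq_zero_of_mem_aroots ι hroot) hnorm
    simpa using nu_eq_of_norm_pow_eq (k := -1) H.one_lt_pow hh (by simpa using this)

open Classical in
theorem negPart_eq (H : IsAdmissible p h a w P G) (ι : Qbar →+* PadicAlgCl p) :
    negPart p ι (p ^ a) (reciprocalLift (pencil w P G)) =
      ((((reciprocalLift (pencil w P G)).aroots (PadicAlgCl p)).filter (‖·‖ < 1)).map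
        fun s => 1 - C s⁻¹ * X).prod := by
  rw [_root_.negPart, inverseRoots, ← map_aroots_Qbar ι, Multiset.filter_map, Multiset.filter_map,
    Multiset.map_map, Multiset.map_map]
  simp only [Function.comp_def, map_inv₀]
  congr 2
  refine Multiset.filter_congr fun β hβ => ?_
  have hβ0 := ne_zero_of_aeval_reciprocalLift_eq_zero H.monic
    (aeval_map_eq_zero_of_mem_aroots ι hβ)
  rw [nu_lt_zero_iff H.one_lt_pow (inv_ne_zero hβ0), norm_inv, one_lt_inv₀ (norm_pos_iff.2 hβ0)]

theorem exists_irreducible_map_eq_negPart (H : IsAdmissible p h a w P G)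
    (ι : Qbar →+* PadicAlgCl p) : ∃ N : ℚ_[p][X], N.map (algebraMap ℚ_[p] (PadicAlgCl p)) =
      negPart p ι (p ^ a) (reciprocalLift (pencil w P G)) ∧ Irreducible N := by
  classical
  obtain ⟨s, hs, hs1⟩ := H.exists_root_one_lt_norm dvd_rfl H.irreducible.degree_pos.ne'
  have hr := aeval_inv_reciprocalLift_eq_zero H.monic hs
  have hr0 := ne_zero_of_aeval_reciprocalLift_eq_zero H.monic hr
  have hr1 : ‖s⁻¹‖ < 1 := by
    rw [norm_inv]
    exact inv_lt_one_of_one_lt₀ hs1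
  have hint : IsIntegral ℚ_[p] s⁻¹ := Algebra.IsIntegral.isIntegral _
  have hc0 := minpoly.coeff_zero_ne_zero hint hr0
  refine ⟨C ((minpoly ℚ_[p] s⁻¹).coeff 0)⁻¹ * minpoly ℚ_[p] s⁻¹, ?_,
    (irreducible_isUnit_mul (isUnit_C.2 (inv_ne_zero hc0).isUnit)).2 (minpoly.irreducible hint)⟩
  rw [Polynomial.map_mul, map_C,
    eq_C_coeff_zero_mul_prod_one_sub ((minpoly.monic hint).map _) (IsAlgClosed.splits _)
      (by rw [coeff_map]; exact (_root_.map_ne_zero _).2 hc0),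
    ← mul_assoc, ← C_mul, coeff_map, ← map_mul, inv_mul_cancel₀ hc0, map_one, C_1, one_mul,
    ← aroots_def, H.aroots_minpoly_eq_filter hr hr1, H.negPart_eq ι]

theorem satisfiesCondition (H : IsAdmissible p h a w P G) (ι : Qbar →+* PadicAlgCl p) :
    SatisfiesCondition p ι (p ^ a) P.natDegree h 1 (reciprocalLift (pencil w P G)) where
  q_eq_pow := ⟨a, H.one_le_a, rfl⟩
  coeff_zero := by rw [coeff_zero_reciprocalLift, H.monic.leadingCoeff]
  natDegree_eq := H.natDegree_lift
  norm_root _ hz := H.norm_eq_one_of_aeval_eq_zero hz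
  not_rootOfUnity _ hz _ hn := H.pow_ne_one hz (Nat.one_le_iff_ne_zero.1 hn)
  integral ℓ _ hℓ := H.mem_lifts ℓ hℓ
  one_le_h := H.one_le_h
  h_le_m := H.natDegree_add ▸ Nat.le_add_left h _
  slopes := H.slopes ι
  one_le_e := le_rfl
  power := ⟨_, H.irreducible, by rw [coeff_zero_reciprocalLift, H.monic.leadingCoeff],
    (pow_one _).symm, H.exists_irreducible_map_eq_negPart ι⟩

theorem isSquare_discr (H : IsAdmissible p h a w P G) {γ : Qbar}
    (hγ : aeval γ (reciprocalLift (pencil w P G)) = 0) : IsSquare (NumberField.discr ℚ⟮γ⟯) := by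
  refine isSquare_discr_of_minpoly_eq_reciprocalLift H.monic
    (adjoin.powerBasis (Algebra.IsIntegral.isIntegral γ)) ?_ H.isSquare_eval
  rw [adjoin.powerBasis_gen]
  exact (minpoly_gen ℚ γ).trans (H.minpoly_eq hγ)

theorem map_lift_eq_prod (H : IsAdmissible p h a w P G) {n : ℕ} {α : Fin n → Qbar}
    (hα : (reciprocalLift (pencil w P G)).aroots Qbar = Finset.univ.val.map α) :
    (reciprocalLift (pencil w P G)).map (algebraMap ℚ Qbar) = ∏ i, (1 - C (α i)⁻¹ * X) := by
  have hcoeff : ((reciprocalLift (pencil w P G)).map (algebraMap ℚ Qbar)).coeff 0 = 1 := by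
    rw [coeff_map, coeff_zero_reciprocalLift, H.monic.leadingCoeff, map_one]
  rw [eq_C_coeff_zero_mul_prod_one_sub (H.monic_lift.map _) (IsAlgClosed.splits _)
    (by rw [hcoeff]; exact one_ne_zero), hcoeff, C_1, one_mul, ← aroots_def, hα, Multiset.map_map]
  rfl

theorem exists_polynomial (H : IsAdmissible p h a w P G) (ι : Qbar →+* PadicAlgCl p) :
    ∃ (L : ℚ[X]) (γ : Fin (2 * P.natDegree) → Qbar) (q : ℕ),
      L.map (algebraMap ℚ Qbar) = ∏ i, (1 - C (γ i) * X) ∧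
      SatisfiesCondition p ι q P.natDegree h 1 L ∧ ∀ i, IsSquare (NumberField.discr ℚ⟮γ i⟯) := by
  obtain ⟨α, hα, -⟩ := H.slopes ι
  refine ⟨_, fun i => (α i)⁻¹, _, H.map_lift_eq_prod hα, H.satisfiesCondition ι, fun i => ?_⟩
  have hmem : α i ∈ (reciprocalLift (pencil w P G)).aroots Qbar := by simp [hα]
  exact H.isSquare_discr (aeval_inv_reciprocalLift_eq_zero H.monic (mem_aroots.1 hmem).2)

end IsAdmissible

section alternation

variable {F : ℝ[X]} {m : ℕ} {x : ℕ → ℝ}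

theorem exists_injective_roots_of_alternating (hx : StrictAntiOn x (Set.Iic m))
    (hF : ∀ k ≤ m, 0 < (-1) ^ k * F.eval (x k)) :
    ∃ y : Fin m → ℝ, y.Injective ∧ ∀ k, y k ∈ Set.Ioo (x m) (x 0) ∧ F.eval (y k) = 0 := by
  have hle {i j : ℕ} (hij : i ≤ j) (hj : j ≤ m) : x j ≤ x i := hx.antitoneOn (hij.trans hj) hj hij
  have hzero (k : Fin m) : ∃ t ∈ Set.Ioo (x (k + 1)) (x k), F.eval t = 0 := by
    have hk := hF k k.2.le
    have hk1 := hF (k + 1) k.2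
    rw [pow_succ] at hk1
    have hstep := hle (Nat.le_succ k) k.2
    obtain hsgn | hsgn := neg_one_pow_eq_or ℝ (k : ℕ) <;> rw [hsgn] at hk hk1
    · exact intermediate_value_Ioo hstep F.continuousOn ⟨by linarith, by linarith⟩
    · exact intermediate_value_Ioo' hstep F.continuousOn ⟨by linarith, by linarith⟩
  choose y hy hFy using hzero
  have hanti : StrictAnti y := fun i j hij =>
    (hy j).2.trans_le ((hle (Nat.succ_le_of_lt hij) j.2.le).trans (hy i).1.le)
  exact ⟨y, hanti.injective, fun k => ⟨⟨(hle k.2 le_rfl).trans_lt (hy k).1,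
    (hy k).2.trans_le (hle (Nat.zero_le k) k.2.le)⟩, hFy k⟩⟩

theorem exists_mem_Ioo_of_alternating (hx : StrictAntiOn x (Set.Iic m)) (hdeg : F.natDegree ≤ m)
    (hF : ∀ k ≤ m, 0 < (-1) ^ k * F.eval (x k)) {z : ℂ} (hz : aeval z F = 0) :
    ∃ t ∈ Set.Ioo (x m) (x 0), (t : ℂ) = z := by
  obtain ⟨y, hinj, hy⟩ := exists_injective_roots_of_alternating hx hF
  have hF0 : F ≠ 0 := by
    rintro rfl
    simpa using hF 0 (Nat.zero_le m)
  have hroots : F.aroots ℂ = (Finset.univ.map ⟨_, Complex.ofReal_injective.comp hinj⟩).val := by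
    refine roots_eq_of_natDegree_le_card_of_ne_zero (fun u hu => ?_) ?_ (map_ne_zero hF0)
    · obtain ⟨k, -, rfl⟩ := Finset.mem_map.1 hu
      change eval (algebraMap ℝ ℂ (y k)) (F.map (algebraMap ℝ ℂ)) = 0
      rw [eval_map_algebraMap, aeval_algebraMap_apply, coe_aeval_eq_eval, (hy k).2, map_zero]
    · rw [Finset.card_map, Finset.card_fin]
      exact natDegree_map_le.trans hdeg
  have hmem : z ∈ F.aroots ℂ := mem_aroots.2 ⟨hF0, hz⟩
  rw [hroots, Finset.mem_val] at hmem
  obtain ⟨k, -, rfl⟩ := Finset.mem_map.1 hmem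
  exact ⟨y k, (hy k).1, rfl⟩

end alternation

section chebyshev

theorem isMonicOfDegree_chebyshev_C (n : ℕ) :
    IsMonicOfDegree (Chebyshev.C ℤ (n + 1)) (n + 1) := by
  induction n using Nat.twoStepInduction with
  | zero => simpa using isMonicOfDegree_X ℤ
  | one =>
    rw [Nat.cast_one, one_add_one_eq_two, Chebyshev.C_two]
    exact (isMonicOfDegree_X_pow ℤ 2).sub (by rw [natDegree_ofNat]; exact two_pos)
  | more n ih0 ih1 =>
    have hrec : Chebyshev.C ℤ ((n + 2 : ℕ) + 1) =
        X * Chebyshev.C ℤ ((n + 1 : ℕ) + 1) - Chebyshev.C ℤ (n + 1) := by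
      push_cast
      rw [← Chebyshev.C_add_two]
      ring_nf
    rw [hrec, show n + 2 + 1 = 1 + (n + 1 + 1) by ring]
    exact ((isMonicOfDegree_X ℤ).mul ih1).sub (by rw [ih0.natDegree_eq]; lia)

theorem even_eval_chebyshev_C {x : ℤ} (hx : Even x) (n : ℤ) : Even ((Chebyshev.C ℤ n).eval x) := by
  induction n using Chebyshev.induct with
  | zero => simp
  | one => simpa using hx
  | add_two n _ ih =>
    rw [Chebyshev.C_add_two, eval_sub, eval_mul, eval_X]
    exact (hx.mul_right _).sub ih
  | neg_add_one n _ ih =>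
    rw [Chebyshev.C_sub_one, eval_sub, eval_mul, eval_X]
    exact (hx.mul_right _).sub ih

theorem eval_chebyshev_C_two_mul_node {m k : ℕ} (hk : k ≤ m) :
    (Chebyshev.C ℝ m).eval (2 * Chebyshev.node m k) = 2 * (-1) ^ k := by
  rw [← Chebyshev.eval_T_real_node (Finset.mem_Iic.2 hk), Chebyshev.node,
    Chebyshev.C_two_mul_real_cos, Chebyshev.T_real_cos]

theorem isMonicOfDegree_chebyshev_C_sub_one {m : ℕ} (hm : 0 < m) :
    IsMonicOfDegree (Chebyshev.C ℤ m - 1) m := by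
  obtain ⟨n, rfl⟩ := Nat.exists_eq_add_of_lt hm
  rw [zero_add, Nat.cast_succ]
  exact (isMonicOfDegree_chebyshev_C n).sub (by rw [natDegree_one]; exact n.succ_pos)

theorem aeval_chebyshev_C_sub_one {A : Type*} [CommRing A] (m : ℤ) (x : A) :
    aeval x (Chebyshev.C ℤ m - 1) = (Chebyshev.C A m).eval x - 1 := by
  rw [map_sub, map_one, Chebyshev.aeval_C]

theorem aeval_chebyshev_C_sub_one_ne_zero {x : ℤ} (hx : Even x) (m : ℤ) :
    aeval (x : ℝ) (Chebyshev.C ℤ m - 1) ≠ 0 := by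
  rw [← eq_intCast (algebraMap ℤ ℝ), aeval_algebraMap_apply, eq_intCast, aeval_chebyshev_C_sub_one,
    Int.cast_ne_zero, sub_ne_zero]
  intro h
  exact Int.not_even_one (h ▸ even_eval_chebyshev_C hx m)

variable {m : ℕ} {w : ℝ} {G : ℤ[X]}

/-- At the nodes `2 * cos (k * π / m)` the polynomial `Chebyshev.C` takes the values `±2`
alternately, which the perturbation `-1 + w * G` cannot compensate. -/
theorem exists_mem_Ioo_of_aeval_pencil_eq_zero (hm : 0 < m) (hG : G.natDegree < m)
    (hbound : ∀ x ∈ Set.Icc (-2 : ℝ) 2, |w * aeval x G| < 1) {z : ℂ}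
    (hz : aeval z (pencil w (Chebyshev.C ℤ m - 1) G) = 0) :
    ∃ t ∈ Set.Ioo (-2 : ℝ) 2, (t : ℂ) = z := by
  have hP := isMonicOfDegree_chebyshev_C_sub_one hm
  have hanti : StrictAntiOn (fun k => 2 * Chebyshev.node m k) (Set.Iic m) :=
    fun i _ j hj hij => mul_lt_mul_of_pos_left (Chebyshev.node_lt hj hij) two_pos
  have hdeg : (pencil w (Chebyshev.C ℤ m - 1) G).natDegree ≤ m := by
    rw [natDegree_pencil _ hP.monic (hP.natDegree_eq.symm ▸ hG), hP.natDegree_eq]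
  have hroot := exists_mem_Ioo_of_alternating hanti hdeg (fun k hk => ?_) hz
  · simpa only [Chebyshev.node_eq_one, Chebyshev.node_eq_neg_one hm.ne', mul_one, mul_neg]
      using hroot
  · have hnode : 2 * Chebyshev.node m k ∈ Set.Icc (-2 : ℝ) 2 := by
      obtain ⟨h1, h2⟩ := Chebyshev.node_mem_Icc (n := m) (i := k)
      constructor <;> linarith
    obtain ⟨h1, h2⟩ := abs_lt.1 (hbound _ hnode)
    rw [← coe_aeval_eq_eval, aeval_pencil, aeval_chebyshev_C_sub_one,
      eval_chebyshev_C_two_mul_node hk, Algebra.algebraMap_self_apply]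
    obtain hsgn | hsgn := neg_one_pow_eq_or ℝ k <;> rw [hsgn] <;> linarith

theorem exists_ofReal_eq_of_aeval_pencil_eq_zero {w : ℚ} (hm : 0 < m) (hG : G.natDegree < m)
    (hbound : ∀ x ∈ Set.Icc (-2 : ℝ) 2, |w * aeval x G| < 1) {z : ℂ}
    (hz : aeval z (pencil w (Chebyshev.C ℤ m - 1) G) = 0) :
    ∃ t ∈ Set.Ioo (-2 : ℝ) 2, (t : ℂ) = z ∧ aeval t (Chebyshev.C ℤ m - 1) = -(w * aeval t G) := by
  rw [← aeval_map_algebraMap ℝ, map_pencil, eq_ratCast] at hz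
  obtain ⟨t, ht, rfl⟩ := exists_mem_Ioo_of_aeval_pencil_eq_zero hm hG hbound hz
  rw [← Complex.coe_algebraMap, aeval_algebraMap_apply, Complex.coe_algebraMap,
    Complex.ofReal_eq_zero, aeval_pencil, Algebra.algebraMap_self_apply] at hz
  exact ⟨t, ht, rfl, eq_neg_of_add_eq_zero_left hz⟩

theorem isSquare_eval_pencil_chebyshev {w : ℚ} (hm : Even m)
    (hsq : IsSquare ((1 + w * aeval 2 G) * (1 + w * aeval (-2) G))) :
    IsSquare ((pencil w (Chebyshev.C ℤ m - 1) G).eval 2 *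
      (pencil w (Chebyshev.C ℤ m - 1) G).eval (-2)) := by
  convert hsq using 2 <;>
    rw [← coe_aeval_eq_eval, aeval_pencil, aeval_chebyshev_C_sub_one, Algebra.algebraMap_self_apply]
  · rw [Chebyshev.C_eval_two]
    norm_num
  · rw [Chebyshev.C_eval_neg_two, Int.negOnePow_even _ ((Int.even_coe_nat m).2 hm)]
    norm_num

end chebyshev

section constructions

theorem padic_norm_int_div_prime_pow {p : ℕ} [Fact p.Prime] {u : ℤ} (hu : ¬ (p : ℤ) ∣ u) (a : ℕ) :
    ‖((u / p ^ a : ℚ) : ℚ_[p])‖ = (p : ℝ) ^ a := by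
  have hnorm : ‖(u : ℚ_[p])‖ = 1 :=
    (Padic.norm_int_le_one u).antisymm (not_lt.1 (mt Padic.norm_intCast_lt_one_iff.1 hu))
  push_cast
  rw [norm_div, norm_pow, Padic.norm_p, hnorm, inv_pow, one_div, inv_inv]

theorem padic_norm_int_div_prime_pow_le_one {p ℓ : ℕ} [Fact p.Prime] [Fact ℓ.Prime] (hℓ : ℓ ≠ p)
    (u : ℤ) (a : ℕ) : ‖((u / p ^ a : ℚ) : ℚ_[ℓ])‖ ≤ 1 := by
  have hp : ‖(p : ℚ_[ℓ])‖ = 1 :=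
    Padic.norm_natCast_eq_one_iff.2 ((Nat.coprime_primes Fact.out Fact.out).2 hℓ)
  push_cast
  rw [norm_div, norm_pow, hp, one_pow, div_one]
  exact Padic.norm_int_le_one u

variable {p h m : ℕ} [Fact p.Prime]

theorem isAdmissible_chebyshev {a : ℕ} {u : ℤ} {G : ℤ[X]} (hm : Even m)
    (hG : IsMonicOfDegree G (m - h)) (h1 : 1 ≤ h) (hhm : h ≤ m) (ha : 1 ≤ a) (hcop : h.Coprime a)
    (hu : ¬ (p : ℤ) ∣ u) (hbound : ∀ x ∈ Set.Icc (-2 : ℝ) 2, |u * aeval x G| < p ^ a)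
    (hroot : ∀ x : ℝ, aeval x G = 0 → ∃ n : ℤ, Even n ∧ (n : ℝ) = x)
    (hsq : IsSquare ((1 + (u / p ^ a : ℚ) * aeval 2 G) * (1 + u / p ^ a * aeval (-2) G))) :
    IsAdmissible p h a (u / p ^ a) (Chebyshev.C ℤ m - 1) G := by
  have hm0 : 0 < m := h1.trans hhm
  have hP := isMonicOfDegree_chebyshev_C_sub_one hm0
  have hp0 : 0 < (p : ℝ) ^ a := by exact_mod_cast pow_pos (Fact.out : p.Prime).pos a
  have hw : ((u / p ^ a : ℚ) : ℝ) = u / p ^ a := by push_cast; rfl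
  have hw0 : (u / p ^ a : ℝ) ≠ 0 :=
    div_ne_zero (Int.cast_ne_zero.2 fun h0 => hu (h0 ▸ dvd_zero _)) hp0.ne'
  have hlt (x : ℝ) (hx : x ∈ Set.Icc (-2) 2) : |((u / p ^ a : ℚ) : ℝ) * aeval x G| < 1 := by
    rw [hw, div_mul_eq_mul_div, abs_div, abs_of_pos hp0, div_lt_one hp0]
    exact hbound x hx
  have hreal {z : ℂ} := exists_ofReal_eq_of_aeval_pencil_eq_zero (z := z) hm0
    (by rw [hG.natDegree_eq]; lia) hlt
  refine ⟨hP.monic, hG.monic, ?_, h1, ha, hcop, padic_norm_int_div_prime_pow hu a,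
    fun ℓ _ hℓ => padic_norm_int_div_prime_pow_le_one hℓ u a, fun z hz => ?_, fun z hz => ?_,
    fun z hz hPz => ?_, isSquare_eval_pencil_chebyshev hm hsq⟩
  · rw [hG.natDegree_eq, hP.natDegree_eq, Nat.sub_add_cancel hhm]
  all_goals obtain ⟨t, ht, rfl, hrel⟩ := hreal hz
  · exact ⟨t, ht, rfl⟩
  · rw [← Complex.coe_algebraMap, aeval_algebraMap_apply, hrel, norm_algebraMap', norm_neg]
    exact hlt t (Set.Ioo_subset_Icc_self ht)
  · rw [← Complex.coe_algebraMap, aeval_algebraMap_apply, Complex.coe_algebraMap,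
      Complex.ofReal_eq_zero] at hPz
    rw [hPz, hw, zero_eq_neg, mul_eq_zero, or_iff_right hw0] at hrel
    obtain ⟨n, hn, rfl⟩ := hroot t hrel
    exact aeval_chebyshev_C_sub_one_ne_zero hn m hPz

theorem two_pow_le_prime_pow (n : ℕ) : (2 : ℝ) ^ n ≤ (p : ℝ) ^ n := by
  have htwo : (2 : ℝ) ≤ p := by exact_mod_cast (Fact.out : p.Prime).two_le
  gcongr

theorem not_prime_dvd_one : ¬ (p : ℤ) ∣ 1 := by
  exact_mod_cast (Fact.out : p.Prime).not_dvd_one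

theorem exists_isAdmissible_self (hm : Even m) (h1 : 1 ≤ m) :
    ∃ a w G, IsAdmissible p m a w (Chebyshev.C ℤ m - 1) G := by
  refine ⟨m * m + 1, _, 1, isAdmissible_chebyshev (u := 1) hm ?_ h1 le_rfl (Nat.le_add_left 1 _)
    (by simp) not_prime_dvd_one (fun x _ => ?_) (fun x hx => ?_)
    ⟨1 + 1 / p ^ (m * m + 1), by simp⟩⟩
  · rw [Nat.sub_self]
    exact isMonicOfDegree_zero_iff.2 rfl
  · rw [Int.cast_one, map_one, mul_one, abs_one]
    exact one_lt_pow₀ (by exact_mod_cast (Fact.out : p.Prime).one_lt) (Nat.succ_ne_zero _)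
  · exact absurd hx (by simp)

theorem aeval_X_add_two {A : Type*} [CommRing A] (x : A) : aeval x (X + 2 : ℤ[X]) = x + 2 := by
  rw [map_add, aeval_X, map_ofNat]

theorem aeval_X_sq_sub_four_mul_X_pow {A : Type*} [CommRing A] (x : A) (k : ℕ) :
    aeval x ((X ^ 2 - 4) * X ^ k : ℤ[X]) = (x ^ 2 - 4) * x ^ k := by
  rw [map_mul, map_sub, map_pow, map_pow, aeval_X, map_ofNat]

theorem exists_isAdmissible_of_add_one_eq (hm : Even m) (h1 : 1 ≤ h) (hhm : h + 1 = m) :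
    ∃ a w G, IsAdmissible p h a w (Chebyshev.C ℤ m - 1) G := by
  have hp0 : (p : ℚ) ≠ 0 := by exact_mod_cast (Fact.out : p.Prime).ne_zero
  have hodd : Odd h := by grind
  have hdvd : (p : ℤ) ∣ p ^ (h * m + 1) := dvd_pow_self _ (Nat.succ_ne_zero _)
  refine ⟨2 * (h * m + 1), _, X + 2, isAdmissible_chebyshev (u := p ^ (h * m + 1) + 1) hm ?_ h1
    (by lia) (by lia) (Nat.Coprime.mul_right (Nat.coprime_two_right.2 hodd) (by simp))
    ((Int.dvd_add_right hdvd).not.2 not_prime_dvd_one) (fun x hx => ?_) (fun x hx => ⟨-2, ?_⟩)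
    ⟨(p ^ (h * m + 1) + 2) / p ^ (h * m + 1), ?_⟩⟩
  · rw [← hhm, Nat.add_sub_cancel_left]
    exact isMonicOfDegree_X_add_one (2 : ℤ)
  · have hlarge : (8 : ℝ) ≤ p ^ (h * m + 1) :=
      calc (8 : ℝ) = 2 ^ 3 := by norm_num
        _ ≤ 2 ^ (h * m + 1) := pow_le_pow_right₀ one_le_two (by nlinarith)
        _ ≤ p ^ (h * m + 1) := two_pow_le_prime_pow _
    rw [aeval_X_add_two, mul_comm 2, pow_mul]
    push_cast
    generalize (p : ℝ) ^ (h * m + 1) = N at hlarge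
    rw [abs_of_nonneg (mul_nonneg (by linarith) (by linarith [hx.1]))]
    nlinarith [hx.2]
  · rw [aeval_X_add_two] at hx
    exact ⟨even_two.neg, by push_cast; linarith⟩
  · rw [aeval_X_add_two, aeval_X_add_two]
    push_cast
    field_simp
    ring

theorem exists_isAdmissible_of_add_two_le (hm : Even m) (h1 : 1 ≤ h) (hhm : h + 2 ≤ m) :
    ∃ a w G, IsAdmissible p h a w (Chebyshev.C ℤ m - 1) G := by
  refine ⟨h * m + 1, _, (X ^ 2 - 4) * X ^ (m - h - 2), isAdmissible_chebyshev (u := 1) hm ?_ h1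
    (by lia) (Nat.le_add_left 1 _) (by simp) not_prime_dvd_one (fun x hx => ?_) (fun x hx => ?_)
    ⟨1, ?_⟩⟩
  · have hquad : IsMonicOfDegree (X ^ 2 - 4 : ℤ[X]) 2 :=
      (isMonicOfDegree_X_pow ℤ 2).sub (by rw [natDegree_ofNat]; exact two_pos)
    convert hquad.mul (isMonicOfDegree_X_pow ℤ (m - h - 2)) using 1
    lia
  · have hquad : |x ^ 2 - 4| ≤ 2 ^ 2 := abs_le.2 ⟨by nlinarith, by nlinarith [hx.1, hx.2]⟩
    have hpow : |x| ^ (m - h - 2) ≤ 2 ^ (m - h - 2) :=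
      pow_le_pow_left₀ (abs_nonneg x) (abs_le.2 hx) _
    calc |((1 : ℤ) : ℝ) * aeval x ((X ^ 2 - 4) * X ^ (m - h - 2) : ℤ[X])|
        = |x ^ 2 - 4| * |x| ^ (m - h - 2) := by
          rw [aeval_X_sq_sub_four_mul_X_pow, Int.cast_one, one_mul, abs_mul, abs_pow]
      _ ≤ 2 ^ 2 * 2 ^ (m - h - 2) := by gcongr
      _ = 2 ^ (m - h) := by rw [← pow_add]; congr 1; lia
      _ < 2 ^ (h * m + 1) := pow_lt_pow_right₀ one_lt_two (by nlinarith [Nat.sub_le m h])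
      _ ≤ p ^ (h * m + 1) := two_pow_le_prime_pow _
  · rw [aeval_X_sq_sub_four_mul_X_pow] at hx
    obtain hsq | hpow := mul_eq_zero.1 hx
    · obtain rfl | rfl := sq_eq_sq_iff_eq_or_eq_neg.1 (show x ^ 2 = 2 ^ 2 by linarith)
      · exact ⟨2, even_two, by norm_num⟩
      · exact ⟨-2, even_two.neg, by norm_num⟩
    · exact ⟨0, Even.zero, by simpa using (eq_zero_of_pow_eq_zero hpow).symm⟩
  · rw [aeval_X_sq_sub_four_mul_X_pow, aeval_X_sq_sub_four_mul_X_pow]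
    norm_num

theorem exists_isAdmissible (hm : Even m) (h1 : 1 ≤ h) (hhm : h ≤ m) :
    ∃ a w G, IsAdmissible p h a w (Chebyshev.C ℤ m - 1) G := by
  obtain hlt | rfl := hhm.lt_or_eq
  · obtain hlt2 | heq := (Nat.succ_le_of_lt hlt).lt_or_eq
    · exact exists_isAdmissible_of_add_two_le hm h1 hlt2
    · exact exists_isAdmissible_of_add_one_eq hm h1 heq
  · exact exists_isAdmissible_self hm h1

end constructions

theorem lemma5p2_general (p : ℕ) [Fact p.Prime] (ι : Qbar →+* PadicAlgCl p) {m h : ℕ}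
    (hm : Even m) (h1 : 1 ≤ h) (hhm : h ≤ m) :
    ∃ (L : ℚ[X]) (γ : Fin (2 * m) → Qbar) (q : ℕ),
      L.map (algebraMap ℚ Qbar) = ∏ i, (1 - C (γ i) * X) ∧
      SatisfiesCondition p ι q m h 1 L ∧ ∀ i, IsSquare (NumberField.discr ℚ⟮γ i⟯) := by
  obtain ⟨a, w, G, H⟩ := exists_isAdmissible (p := p) hm h1 hhm
  have hL := H.exists_polynomial ι
  rwa [(isMonicOfDegree_chebyshev_C_sub_one (h1.trans hhm)).natDegree_eq] at hL

theorem lemma5p2 (p : ℕ) [Fact p.Prime] (ι : Qbar →+* PadicAlgCl p)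
    (h' : ℕ) (h1 : 1 ≤ h') (h10 : h' ≤ 10) :
    ∃ (L : ℚ[X]) (γ : Fin 20 → Qbar) (q e : ℕ),
      L.map (algebraMap ℚ Qbar) = ∏ i, (1 - C (γ i) * X) ∧
      SatisfiesCondition p ι q 10 h' e L ∧
      (IsSquare (NumberField.discr ℚ⟮γ 0⟯) ∨ Even e) := by
  obtain ⟨L, γ, q, hprod, hL, hdiscr⟩ := lemma5p2_general p ι (m := 10) (by decide) h1 h10
  exact ⟨L, γ, q, 1, hprod, hL, .inl (hdiscr 0)⟩
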